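/- All Banach spaces are real. A lattice homomorphism between Banach lattices is a bounded linear operator preserving the lattice operations. For a Banach space $E$ with dual $E^*$ and closed unit ball $B_E$, and for a positively homogeneous function $f:E^*\to\mathbb R$ (i.e. $f(\lambda x^*)=\lambda f(x^*)$ for all $\lambda>0$ and $x^*\in E^*$), put $$\|f\|_{FBL[E]}:=\sup\Big\{\sum_{i=1}^n|f(x_i^*)| : n\in\mathbb N,\ x_1^*,\dots,x_n^*\in E^*,\ \sup_{x\in B_E}\sum_{i=1}^n|x_i^*(x)|\le 1\Big\}\in[0,\infty],$$ and let $H_0[E]$ be the space of all positively homogeneous $f$ with $\|f\|_{FBL[E]}<\infty$, with this norm and the pointwise order. The free Banach lattice $FBL[E]$ is the closed vector sublattice of $H_0[E]$ generated by the evaluations $\delta_E(x):x^*\mapsto x^*(x)$, $x\in E$. For a Banach lattice $X$, let $\beta_X:FBL[X]\to X$ be the unique lattice homomorphism with $\beta_X\circ\delta_X=\mathrm{id}_X$. The Banach lattice $X$ has the isometric lattice-lifting property if there is a lattice homomorphism $T:X\to FBL[X]$ with $\beta_X\circ T=\mathrm{id}_X$ and $\|T\|=1$. A compact Hausdorff space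 $K$ is an absolute retract if it is a retract of every compact Hausdorff space $L$ containing it, i.e. there is a continuous map $L\to K$ that is the identity on $K$. Let $Hom(X,\mathbb R)\subseteq X^*$ be the set of all lattice homomorphisms from $X$ to $\mathbb R$, let $B_{X^*}$ be the closed unit ball of $X^*$, and let $w^*$ denote the weak$^*$ topology. **Corollary.** Let $X$ be a separable Banach lattice with the isometric lattice-lifting property. Then $(Hom(X,\mathbb R)\cap B_{X^*},w^*)$ is a compact Hausdorff space that is an absolute retract. -/

import Mathlib

open scoped ENNReal

universe u v

noncomputable section

namespace BanachLattice

/-- A bounded linear operator is a lattice homomorphism if it preserves the lattice operations. -/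
def IsLatticeHom {X Y : Type*} [NormedAddCommGroup X] [NormedSpace ℝ X] [Lattice X]
    [NormedAddCommGroup Y] [NormedSpace ℝ Y] [Lattice Y] (T : X →L[ℝ] Y) : Prop :=
  ∀ x y : X, T (x ⊔ y) = T x ⊔ T y ∧ T (x ⊓ y) = T x ⊓ T y

section FreeBanachLattice

variable (E : Type*) [NormedAddCommGroup E] [NormedSpace ℝ E]

/-- A function on the dual is positively homogeneous if `f (c • φ) = c * f φ` for all `c > 0`. -/
def PosHomogeneous (f : StrongDual ℝ E → ℝ) : Prop :=
  ∀ (c : ℝ) (φ : StrongDual ℝ E), 0 < c → f (c • φ) = c * f φ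

/-- The extended free Banach lattice norm of a function `f` on the dual of `E`: the supremum of
`∑ i, |f (φ i)|` over all finite families `φ` of functionals such that
`∑ i, |φ i x| ≤ 1` for all `x` in the closed unit ball of `E`. -/
def fblENorm (f : StrongDual ℝ E → ℝ) : ℝ≥0∞ :=
  ⨆ (n : ℕ) (φ : Fin n → StrongDual ℝ E) (_ : ∀ x : E, ‖x‖ ≤ 1 → ∑ i, |φ i x| ≤ 1),
    ∑ i, ENNReal.ofReal |f (φ i)|

variable {E}

theorem le_fblENorm (f : StrongDual ℝ E → ℝ) {n : ℕ} (φ : Fin n → StrongDual ℝ E)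
    (h : ∀ x : E, ‖x‖ ≤ 1 → ∑ i, |φ i x| ≤ 1) :
    ∑ i, ENNReal.ofReal |f (φ i)| ≤ fblENorm E f :=
  le_iSup_of_le n (le_iSup₂_of_le φ h le_rfl)

theorem fblENorm_le_add {f g h : StrongDual ℝ E → ℝ} (H : ∀ φ, |h φ| ≤ |f φ| + |g φ|) :
    fblENorm E h ≤ fblENorm E f + fblENorm E g := by
  refine iSup_le fun n => iSup₂_le fun φ hφ => ?_
  calc ∑ i, ENNReal.ofReal |h (φ i)|
      ≤ ∑ i, (ENNReal.ofReal |f (φ i)| + ENNReal.ofReal |g (φ i)|) := by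
        refine Finset.sum_le_sum fun i _ => ?_
        rw [← ENNReal.ofReal_add (abs_nonneg _) (abs_nonneg _)]
        exact ENNReal.ofReal_le_ofReal (H _)
    _ = ∑ i, ENNReal.ofReal |f (φ i)| + ∑ i, ENNReal.ofReal |g (φ i)| :=
        Finset.sum_add_distrib
    _ ≤ _ := add_le_add (le_fblENorm f φ hφ) (le_fblENorm g φ hφ)

theorem fblENorm_zero : fblENorm E (0 : StrongDual ℝ E → ℝ) = 0 := by
  simp [fblENorm]

theorem fblENorm_smul (c : ℝ) (f : StrongDual ℝ E → ℝ) :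
    fblENorm E (c • f) = ENNReal.ofReal |c| * fblENorm E f := by
  simp only [fblENorm, ENNReal.mul_iSup, Finset.mul_sum, Pi.smul_apply, smul_eq_mul, abs_mul,
    ENNReal.ofReal_mul (abs_nonneg c)]

variable (E)

/-- The positively homogeneous functions on the dual with finite free Banach lattice norm, as a
space of functions. -/
def h0Submodule : Submodule ℝ (StrongDual ℝ E → ℝ) where
  carrier := {f | PosHomogeneous E f ∧ fblENorm E f < ∞}
  zero_mem' := ⟨fun c φ _ => by simp, by simp [fblENorm_zero]⟩
  add_mem' := by
    rintro f g ⟨hf, hf'⟩ ⟨hg, hg'⟩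
    refine ⟨fun c φ hc => ?_, lt_of_le_of_lt (fblENorm_le_add fun φ => ?_)
      (ENNReal.add_lt_top.2 ⟨hf', hg'⟩)⟩
    · simp only [Pi.add_apply, hf c φ hc, hg c φ hc]; ring
    · exact abs_add_le _ _
  smul_mem' := by
    rintro a f ⟨hf, hf'⟩
    refine ⟨fun c φ hc => ?_, ?_⟩
    · simp only [Pi.smul_apply, smul_eq_mul, hf c φ hc]; ring
    · rw [fblENorm_smul]; exact ENNReal.mul_lt_top ENNReal.ofReal_lt_top hf'

/-- The space `H₀[E]` of positively homogeneous functions on the dual of `E` with finite free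
Banach lattice norm. It is a type of its own, so that its topology is that of the norm below
and not that of pointwise convergence. -/
def H0 : Type _ := h0Submodule E

namespace H0

instance : AddCommGroup (H0 E) := inferInstanceAs (AddCommGroup (h0Submodule E))

instance : Module ℝ (H0 E) := inferInstanceAs (Module ℝ (h0Submodule E))

variable {E}

/-- The function on the dual that underlies an element of `H₀[E]`. -/
def toFun (f : H0 E) : StrongDual ℝ E → ℝ := Subtype.val f

theorem sup_mem {f g : StrongDual ℝ E → ℝ} (hf : f ∈ h0Submodule E) (hg : g ∈ h0Submodule E) :
    f ⊔ g ∈ h0Submodule E := by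
  refine ⟨fun c φ hc => ?_, lt_of_le_of_lt (fblENorm_le_add (f := f) (g := g) fun φ => ?_)
    (ENNReal.add_lt_top.2 ⟨hf.2, hg.2⟩)⟩
  · simp only [Pi.sup_apply, hf.1 c φ hc, hg.1 c φ hc]
    exact (mul_max_of_nonneg _ _ hc.le).symm
  · exact abs_max_le_max_abs_abs.trans
      (max_le_add_of_nonneg (abs_nonneg _) (abs_nonneg _))

theorem inf_mem {f g : StrongDual ℝ E → ℝ} (hf : f ∈ h0Submodule E) (hg : g ∈ h0Submodule E) :
    f ⊓ g ∈ h0Submodule E := by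
  refine ⟨fun c φ hc => ?_, lt_of_le_of_lt (fblENorm_le_add (f := f) (g := g) fun φ => ?_)
    (ENNReal.add_lt_top.2 ⟨hf.2, hg.2⟩)⟩
  · simp only [Pi.inf_apply, hf.1 c φ hc, hg.1 c φ hc]
    exact (mul_min_of_nonneg _ _ hc.le).symm
  · exact abs_min_le_max_abs_abs.trans
      (max_le_add_of_nonneg (abs_nonneg _) (abs_nonneg _))

/-- The pointwise order. -/
instance : Lattice (H0 E) :=
  Subtype.lattice (P := fun f => f ∈ h0Submodule E) (fun _ _ hf hg => sup_mem hf hg)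
    (fun _ _ hf hg => inf_mem hf hg)

/-- The free Banach lattice norm. -/
instance : Norm (H0 E) := ⟨fun f => (fblENorm E f.toFun).toReal⟩

theorem norm_def (f : H0 E) : ‖f‖ = (fblENorm E f.toFun).toReal := rfl

theorem fblENorm_ne_top (f : H0 E) : fblENorm E f.toFun ≠ ∞ := (Subtype.property f).2.ne

theorem normCore : NormedSpace.Core ℝ (H0 E) where
  norm_nonneg f := ENNReal.toReal_nonneg
  norm_smul c f := by
    rw [norm_def, norm_def, show (c • f).toFun = c • f.toFun from rfl, fblENorm_smul,
      ENNReal.toReal_mul, ENNReal.toReal_ofReal (abs_nonneg c), Real.norm_eq_abs]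
  norm_triangle f g := by
    rw [norm_def, norm_def, norm_def,
      ← ENNReal.toReal_add f.fblENorm_ne_top g.fblENorm_ne_top]
    refine ENNReal.toReal_mono
      (ENNReal.add_ne_top.2 ⟨f.fblENorm_ne_top, g.fblENorm_ne_top⟩)
      (fblENorm_le_add fun φ => ?_)
    exact abs_add_le (f.toFun φ) (g.toFun φ)
  norm_eq_zero_iff f := by
    constructor
    · intro h
      have h0 : fblENorm E f.toFun = 0 :=
        ((ENNReal.toReal_eq_zero_iff _).1 h).resolve_right f.fblENorm_ne_top
      have key : ∀ ψ : StrongDual ℝ E, ‖ψ‖ ≤ 1 → f.toFun ψ = 0 := by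
        intro ψ hψ
        have := le_fblENorm f.toFun (fun _ : Fin 1 => ψ) (fun x hx => by
          have h1 : |ψ x| ≤ ‖ψ‖ * ‖x‖ := ψ.le_opNorm x
          have h2 : ‖ψ‖ * ‖x‖ ≤ 1 := mul_le_one₀ hψ (norm_nonneg x) hx
          simpa using h1.trans h2)
        rw [h0] at this
        simpa using this
      apply Subtype.ext
      funext ψ
      change f.toFun ψ = 0
      have hpos : 0 < ‖ψ‖ + 1 := by positivity
      have e : f.toFun ((‖ψ‖ + 1)⁻¹ • ψ) = (‖ψ‖ + 1)⁻¹ * f.toFun ψ :=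
        (Subtype.property f).1 _ ψ (inv_pos.2 hpos)
      have z : f.toFun ((‖ψ‖ + 1)⁻¹ • ψ) = 0 := by
        apply key
        rw [norm_smul, norm_inv, Real.norm_of_nonneg hpos.le, inv_mul_le_one₀ hpos]
        linarith
      rw [e] at z
      exact (mul_eq_zero.1 z).resolve_left (inv_ne_zero hpos.ne')
    · rintro rfl
      rw [norm_def, show (0 : H0 E).toFun = 0 from rfl, fblENorm_zero, ENNReal.toReal_zero]

instance : NormedAddCommGroup (H0 E) := NormedAddCommGroup.ofCore normCore

instance : NormedSpace ℝ (H0 E) := NormedSpace.ofCore normCore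

/-- The evaluation map `φ ↦ φ x`, as an element of `H₀[E]`. -/
def delta (x : E) : H0 E :=
  ⟨fun φ => φ x, fun c φ _ => by simp, by
    refine lt_of_le_of_lt (b := ENNReal.ofReal ‖x‖) ?_ ENNReal.ofReal_lt_top
    refine iSup_le fun n => iSup₂_le fun φ hφ => ?_
    rw [← ENNReal.ofReal_sum_of_nonneg fun i _ => abs_nonneg _]
    refine ENNReal.ofReal_le_ofReal ?_
    rcases eq_or_ne x 0 with rfl | hx
    · simp
    · have hx' : 0 < ‖x‖ := norm_pos_iff.2 hx
      have := hφ (‖x‖⁻¹ • x) (by rw [norm_smul, norm_inv, norm_norm, inv_mul_cancel₀ hx'.ne'])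
      simp only [map_smul, smul_eq_mul, abs_mul, ← Finset.mul_sum, abs_inv, abs_norm] at this
      rwa [inv_mul_le_one₀ hx'] at this⟩

end H0

/-- The free Banach lattice `FBL[E]` generated by the Banach space `E`: the closed vector
sublattice of `H₀[E]` generated by the evaluations, that is, the intersection of all closed
vector sublattices of `H₀[E]` that contain them. -/
def FBL : Submodule ℝ (H0 E) :=
  sInf {S | IsClosed (S : Set (H0 E)) ∧
    (∀ f ∈ S, ∀ g ∈ S, f ⊔ g ∈ S ∧ f ⊓ g ∈ S) ∧ ∀ x : E, H0.delta x ∈ S}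

namespace FBL

instance : Lattice (FBL E) :=
  Subtype.lattice (P := fun f => f ∈ FBL E)
    (fun {f g} hf hg => (Submodule.mem_sInf).2 fun S hS =>
      (hS.2.1 f ((Submodule.mem_sInf).1 hf S hS) g ((Submodule.mem_sInf).1 hg S hS)).1)
    (fun {f g} hf hg => (Submodule.mem_sInf).2 fun S hS =>
      (hS.2.1 f ((Submodule.mem_sInf).1 hf S hS) g ((Submodule.mem_sInf).1 hg S hS)).2)

variable {E}

/-- The canonical map `δ_E : E → FBL[E]`. -/
def delta (x : E) : FBL E :=
  ⟨H0.delta x, (Submodule.mem_sInf).2 fun _ hS => hS.2.2 x⟩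

end FBL

end FreeBanachLattice

section CanonicalMap

set_option linter.unusedSectionVars false

/-! The canonical map `β_X : FBL[X] → X` exists and is unique. -/

namespace H0

variable {E : Type*} [NormedAddCommGroup E] [NormedSpace ℝ E]

theorem ext_toFun {f g : H0 E} (h : ∀ φ, f.toFun φ = g.toFun φ) : f = g :=
  Subtype.ext (funext h)

theorem toFun_abs (f : H0 E) (φ : StrongDual ℝ E) : |f|.toFun φ = |f.toFun φ| := rfl

theorem norm_le_norm_of_abs {f g : H0 E} (h : ∀ φ, |f.toFun φ| ≤ |g.toFun φ|) : ‖f‖ ≤ ‖g‖ := by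
  refine ENNReal.toReal_mono g.fblENorm_ne_top ?_
  have := fblENorm_le_add (f := g.toFun) (g := 0) (h := f.toFun) (fun φ => by simpa using h φ)
  simpa [fblENorm_zero] using this

instance : IsOrderedAddMonoid (H0 E) where
  add_le_add_left _ _ h k := fun φ => add_le_add_left (h φ) (k.toFun φ)

instance : HasSolidNorm (H0 E) where
  solid _ _ h := norm_le_norm_of_abs fun φ => h φ

end H0

variable {X : Type*} [NormedAddCommGroup X] [NormedSpace ℝ X] [Lattice X]

theorem exists_le_sublinear (N : X → ℝ) (h1 : ∀ c : ℝ, 0 < c → ∀ x, N (c • x) = c * N x)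
    (h2 : ∀ x y, N (x + y) ≤ N x + N y) (h0 : N 0 = 0) (x₀ : X) :
    ∃ g : X →ₗ[ℝ] ℝ, (∀ x, g x ≤ N x) ∧ g x₀ = N x₀ := by
  rcases eq_or_ne x₀ 0 with rfl | hx
  · obtain ⟨g, -, hg⟩ := exists_extension_of_le_sublinear (⊥ : X →ₗ.[ℝ] ℝ) N h1 h2 (by
      rintro ⟨x, hx⟩
      have hx' : x = 0 := (Submodule.mem_bot ℝ).1 hx
      subst hx'
      have : (⊥ : X →ₗ.[ℝ] ℝ) ⟨0, hx⟩ = 0 := LinearPMap.map_zero _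
      rw [this]
      exact h0.ge)
    exact ⟨g, hg, by simp [h0]⟩
  · obtain ⟨g, hg', hg⟩ := exists_extension_of_le_sublinear
      (LinearPMap.mkSpanSingleton x₀ (N x₀) hx) N h1 h2 (by
        rintro ⟨x, hx'⟩
        obtain ⟨t, rfl⟩ := Submodule.mem_span_singleton.1 hx'
        have ht : (LinearPMap.mkSpanSingleton x₀ (N x₀) hx) ⟨t • x₀, hx'⟩ = t • N x₀ :=
          LinearPMap.mkSpanSingleton'_apply _ _ _ _ _
        rw [ht]
        simp only [smul_eq_mul]
        rcases lt_trichotomy t 0 with ht | rfl | ht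
        · have := h2 (t • x₀) ((-t) • x₀)
          rw [← add_smul, add_neg_cancel, zero_smul, h0, h1 (-t) (by linarith)] at this
          linarith
        · simp [h0]
        · rw [h1 t ht])
    refine ⟨g, hg, ?_⟩
    have := hg' ⟨x₀, Submodule.mem_span_singleton_self x₀⟩
    rw [this]
    exact LinearPMap.mkSpanSingleton_apply (K := ℝ) _ hx (N x₀)

/-- Positive functionals. -/
def Pos (φ : StrongDual ℝ X) : Prop := ∀ x, 0 ≤ x → 0 ≤ φ x


/-- `Dec R φ`: the functional `φ` is a finite sum of functionals with property `R`. -/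
inductive Dec (R : StrongDual ℝ X → Prop) : StrongDual ℝ X → Prop
  | base (φ : StrongDual ℝ X) : R φ → Dec R φ
  | add (φ ψ : StrongDual ℝ X) : Dec R φ → Dec R ψ → Dec R (φ + ψ)

theorem Dec.bind {R R' : StrongDual ℝ X → Prop} {φ : StrongDual ℝ X} (h : Dec R φ)
    (H : ∀ χ, R χ → Dec R' χ) : Dec R' φ := by
  induction h with
  | base φ hφ => exact H φ hφ
  | add φ ψ _ _ h1 h2 => exact Dec.add _ _ h1 h2

theorem Dec.exists_fin {R : StrongDual ℝ X → Prop} {φ : StrongDual ℝ X} (h : Dec R φ) :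
    ∃ (n : ℕ) (Φ : Fin n → StrongDual ℝ X), (∀ i, R (Φ i)) ∧ ∑ i, Φ i = φ := by
  induction h with
  | base φ hφ => exact ⟨1, fun _ => φ, fun _ => hφ, by simp⟩
  | add φ ψ _ _ h1 h2 =>
    obtain ⟨n, Φ, hΦ, rfl⟩ := h1
    obtain ⟨m, Ψ, hΨ, rfl⟩ := h2
    refine ⟨n + m, Fin.append Φ Ψ, fun i => ?_, by simp [Fin.sum_univ_add]⟩
    refine Fin.addCases (fun i => ?_) (fun i => ?_) i
    · simpa using hΦ i
    · simpa using hΨ i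

/-- `f` evaluates as `z` at all positive functionals below `χ`. -/
def Agree (f : H0 X) (z : X) (χ : StrongDual ℝ X) : Prop :=
  Pos χ ∧ ∀ ψ : StrongDual ℝ X, Pos ψ → Pos (χ - ψ) → f.toFun ψ = ψ z

theorem Agree.mono {f : H0 X} {z : X} {χ χ' : StrongDual ℝ X} (h : Agree f z χ) (h' : Pos χ')
    (hle : Pos (χ - χ')) : Agree f z χ' := by
  refine ⟨h', fun ψ hψ hψ' => h.2 ψ hψ fun x hx => ?_⟩
  have h1 := hle x hx
  have h2 := hψ' x hx
  simp only [_root_.sub_apply] at h1 h2 ⊢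
  linarith

/-- All parts of a decomposition into positive parts lie below the whole. -/
theorem Dec.parts_le {R : StrongDual ℝ X → Prop} (hR : ∀ χ, R χ → Pos χ) {φ : StrongDual ℝ X}
    (h : Dec R φ) : Pos φ ∧
      ∀ θ, Pos (θ - φ) → Dec (fun χ => R χ ∧ Pos (θ - χ)) φ := by
  induction h with
  | base φ hφ => exact ⟨hR φ hφ, fun θ hθ => Dec.base φ ⟨hφ, hθ⟩⟩
  | add φ ψ _ _ h1 h2 =>
    refine ⟨fun x hx => add_nonneg (h1.1 x hx) (h2.1 x hx), fun θ hθ => ?_⟩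
    refine Dec.add φ ψ (h1.2 θ fun x hx => ?_) (h2.2 θ fun x hx => ?_)
    · have e1 := hθ x hx
      have e2 := h2.1 x hx
      simp only [_root_.sub_apply, _root_.add_apply] at e1 ⊢
      linarith
    · have e1 := hθ x hx
      have e2 := h1.1 x hx
      simp only [_root_.sub_apply, _root_.add_apply] at e1 ⊢
      linarith

theorem Dec.agree_and {f g : H0 X} {z w : X} {φ : StrongDual ℝ X}
    (hf : Dec (Agree f z) φ) (hg : ∀ χ : StrongDual ℝ X, Pos χ → Dec (Agree g w) χ) :
    Dec (fun χ => Agree f z χ ∧ Agree g w χ) φ := by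
  refine hf.bind fun χ hχ => ?_
  refine (((hg χ hχ.1).parts_le fun _ h => h.1).2 χ fun x _ => by simp).bind fun χ' h => ?_
  exact Dec.base χ' ⟨hχ.mono h.1.1 h.2, h.1⟩

variable (X) in
/-- Pairs `(f, z)` in which `z` is the value of `f` on `X`, as seen by positive functionals. -/
def preGraph : Submodule ℝ (H0 X × X) where
  carrier := {p | ∀ φ : StrongDual ℝ X, Pos φ → Dec (Agree p.1 p.2) φ}
  zero_mem' := fun φ hφ => Dec.base φ ⟨hφ, fun ψ _ _ => by
    change (0 : ℝ) = ψ (0 : X)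
    simp⟩
  add_mem' := by
    rintro ⟨f, z⟩ ⟨g, w⟩ hf hg φ hφ
    refine ((hf φ hφ).agree_and hg).bind fun χ hχ => Dec.base χ ⟨hχ.1.1, fun ψ h1 h2 => ?_⟩
    change f.toFun ψ + g.toFun ψ = ψ (z + w)
    rw [hχ.1.2 ψ h1 h2, hχ.2.2 ψ h1 h2, map_add]
  smul_mem' := by
    rintro c ⟨f, z⟩ hf φ hφ
    refine (hf φ hφ).bind fun χ hχ => Dec.base χ ⟨hχ.1, fun ψ h1 h2 => ?_⟩
    change c * f.toFun ψ = ψ (c • z)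
    rw [hχ.2 ψ h1 h2]
    simp

theorem delta_mem_preGraph (x : X) : (H0.delta x, x) ∈ preGraph X :=
  fun φ hφ => Dec.base φ ⟨hφ, fun _ _ _ => rfl⟩

variable [HasSolidNorm X] [IsOrderedAddMonoid X] [IsOrderedModule ℝ X]

theorem smul_posPart_of_pos {c : ℝ} (hc : 0 < c) (x : X) : (c • x)⁺ = c • x⁺ := by
  rw [posPart_def, posPart_def]
  refine le_antisymm (sup_le (smul_le_smul_of_nonneg_left le_sup_left hc.le)
    (smul_nonneg hc.le le_sup_right)) ?_
  rw [← le_inv_smul_iff_of_pos hc]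
  refine sup_le ?_ (smul_nonneg (inv_pos.2 hc).le le_sup_right)
  rw [le_inv_smul_iff_of_pos hc]
  exact le_sup_left

theorem posPart_add_le (x y : X) : (x + y)⁺ ≤ x⁺ + y⁺ := by
  rw [posPart_def (x + y)]
  exact sup_le (add_le_add (le_posPart x) (le_posPart y))
    (add_nonneg (posPart_nonneg x) (posPart_nonneg y))

theorem Pos.mono {φ : StrongDual ℝ X} (h : Pos φ) {x y : X} (hxy : x ≤ y) : φ x ≤ φ y := by
  have := h (y - x) (sub_nonneg.2 hxy)
  rw [map_sub] at this
  linarith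

theorem Pos.abs_le {φ : StrongDual ℝ X} (h : Pos φ) (x : X) : |φ x| ≤ φ |x| := by
  rw [_root_.abs_le]
  have h1 := h.mono (neg_le_abs x)
  rw [map_neg] at h1
  exact ⟨by linarith, h.mono (le_abs_self x)⟩

/-- A positive functional splits into two positive parts, one of which sees `u ⊔ v` as `u`, the
other as `v`. -/
theorem Pos.split {φ : StrongDual ℝ X} (h : Pos φ) (u v : X) :
    ∃ φ₁ φ₂ : StrongDual ℝ X, Pos φ₁ ∧ Pos φ₂ ∧ φ₁ + φ₂ = φ ∧
      φ₁ (u ⊔ v) = φ₁ u ∧ φ₂ (u ⊔ v) = φ₂ v := by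
  obtain ⟨g, hg, hg0⟩ := exists_le_sublinear (fun x : X => φ x⁺)
    (fun c hc x => by simp [smul_posPart_of_pos hc])
    (fun x y => by simpa using h.mono (posPart_add_le x y)) (by simp) (u - v)
  have gpos : ∀ x, 0 ≤ x → 0 ≤ g x := fun x hx => by
    have := hg (-x)
    rw [posPart_eq_zero.2 (neg_nonpos.2 hx)] at this
    simpa using this
  have gle : ∀ x, 0 ≤ x → g x ≤ φ x := fun x hx => by
    have := hg x
    rwa [posPart_eq_self.2 hx] at this
  have gbound : ∀ x, ‖g x‖ ≤ ‖φ‖ * ‖x‖ := fun x => by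
    have hb : ∀ y, g y ≤ ‖φ‖ * ‖y‖ := fun y => by
      refine (hg y).trans ((le_abs_self _).trans ((φ.le_opNorm _).trans ?_))
      refine mul_le_mul_of_nonneg_left (HasSolidNorm.solid ?_) (norm_nonneg _)
      rw [abs_of_nonneg (posPart_nonneg y)]
      exact sup_le (le_abs_self y) (abs_nonneg y)
    rw [Real.norm_eq_abs, _root_.abs_le]
    have h1 := hb (-x)
    rw [map_neg, norm_neg] at h1
    exact ⟨by linarith, hb x⟩
  have e : u ⊔ v = v + (u - v)⁺ := by
    rw [posPart_def, add_sup, add_sub_cancel, add_zero]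
  have hle : g (u - v) ≤ g (u - v)⁺ := by
    have := gpos _ (sub_nonneg.2 (le_posPart (u - v)))
    rw [map_sub] at this
    linarith
  have hge := gle _ (posPart_nonneg (u - v))
  have hg0' : g (u - v) = φ (u - v)⁺ := hg0
  have huv : g (u - v) = g u - g v := map_sub _ _ _
  refine ⟨g.mkContinuous ‖φ‖ gbound, φ - g.mkContinuous ‖φ‖ gbound, fun x hx => gpos x hx,
    fun x hx => ?_, by abel, ?_, ?_⟩
  · have := gle x hx
    simpa using this
  · change g (u ⊔ v) = g u
    rw [e, map_add]
    linarith
  · change φ (u ⊔ v) - g (u ⊔ v) = φ v - g v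
    rw [e, map_add, map_add]
    linarith

theorem exists_pos_norming (z : X) :
    ∃ φ : StrongDual ℝ X, Pos φ ∧ (∀ x, |φ x| ≤ ‖x‖) ∧ φ |z| = ‖z‖ := by
  have hn : ∀ x : X, ‖x⁺‖ ≤ ‖x‖ := fun x => HasSolidNorm.solid (by
    rw [abs_of_nonneg (posPart_nonneg x)]
    exact sup_le (le_abs_self x) (abs_nonneg x))
  obtain ⟨g, hg, hg0⟩ := exists_le_sublinear (fun x : X => ‖x⁺‖)
    (fun c hc x => by simp [smul_posPart_of_pos hc, norm_smul, abs_of_pos hc])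
    (fun x y => by
      refine le_trans (HasSolidNorm.solid ?_) (norm_add_le x⁺ y⁺)
      rw [abs_of_nonneg (posPart_nonneg _),
        abs_of_nonneg (add_nonneg (posPart_nonneg x) (posPart_nonneg y))]
      exact posPart_add_le x y) (by simp) |z|
  have gb : ∀ x, |g x| ≤ ‖x‖ := fun x => by
    rw [_root_.abs_le]
    have h1 := (hg (-x)).trans (hn (-x))
    rw [map_neg, norm_neg] at h1
    exact ⟨by linarith, (hg x).trans (hn x)⟩
  refine ⟨g.mkContinuous 1 fun x => by simpa using gb x, fun x hx => ?_, gb, ?_⟩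
  · have := hg (-x)
    rw [posPart_eq_zero.2 (neg_nonpos.2 hx)] at this
    simpa using this
  · change g |z| = ‖z‖
    rw [hg0, posPart_eq_self.2 (abs_nonneg z), norm_abs_eq_norm]

theorem sup_mem_preGraph {p q : H0 X × X} (hp : p ∈ preGraph X) (hq : q ∈ preGraph X) :
    p ⊔ q ∈ preGraph X := by
  obtain ⟨f, z⟩ := p
  obtain ⟨g, w⟩ := q
  intro φ hφ
  refine ((hp φ hφ).agree_and hq).bind fun χ hχ => ?_
  obtain ⟨χ₁, χ₂, p₁, p₂, hs, e₁, e₂⟩ := hχ.1.1.split z w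
  rw [← hs]
  refine Dec.add _ _ (Dec.base _ ⟨p₁, fun ψ h1 h2 => ?_⟩) (Dec.base _ ⟨p₂, fun ψ h1 h2 => ?_⟩)
  · have hle : Pos (χ - ψ) := fun x hx => by
      have a1 := h2 x hx
      have a2 := p₂ x hx
      rw [← hs]
      simp only [_root_.sub_apply, _root_.add_apply] at a1 ⊢
      linarith
    change max (f.toFun ψ) (g.toFun ψ) = ψ (z ⊔ w)
    rw [hχ.1.2 ψ h1 hle, hχ.2.2 ψ h1 hle]
    have b1 := h2 (z ⊔ w - z) (sub_nonneg.2 le_sup_left)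
    have b2 := h1.mono (le_sup_left : z ≤ z ⊔ w)
    have b3 := h1.mono (le_sup_right : w ≤ z ⊔ w)
    simp only [_root_.sub_apply, map_sub, e₁] at b1
    rw [max_eq_left (by linarith)]
    linarith
  · have hle : Pos (χ - ψ) := fun x hx => by
      have a1 := h2 x hx
      have a2 := p₁ x hx
      rw [← hs]
      simp only [_root_.sub_apply, _root_.add_apply] at a1 ⊢
      linarith
    change max (f.toFun ψ) (g.toFun ψ) = ψ (z ⊔ w)
    rw [hχ.1.2 ψ h1 hle, hχ.2.2 ψ h1 hle]
    have b1 := h2 (z ⊔ w - w) (sub_nonneg.2 le_sup_right)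
    have b2 := h1.mono (le_sup_left : z ≤ z ⊔ w)
    have b3 := h1.mono (le_sup_right : w ≤ z ⊔ w)
    simp only [_root_.sub_apply, map_sub, e₂] at b1
    rw [max_eq_right (by linarith)]
    linarith

theorem inf_mem_of_sup_mem {V : Type*} [AddCommGroup V] [Module ℝ V] [Lattice V]
    [IsOrderedAddMonoid V] (S : Submodule ℝ V) (h : ∀ p ∈ S, ∀ q ∈ S, p ⊔ q ∈ S) {p q : V}
    (hp : p ∈ S) (hq : q ∈ S) : p ⊓ q ∈ S := by
  have := S.neg_mem (h _ (S.neg_mem hp) _ (S.neg_mem hq))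
  rwa [neg_sup, neg_neg, neg_neg] at this

theorem norm_le_of_mem_preGraph {p : H0 X × X} (hp : p ∈ preGraph X) : ‖p.2‖ ≤ ‖p.1‖ := by
  have hp' : |p| ∈ preGraph X := sup_mem_preGraph hp ((preGraph X).neg_mem hp)
  obtain ⟨f, z⟩ := p
  obtain ⟨φ, hφ, hb, hn⟩ := exists_pos_norming z
  obtain ⟨n, Φ, hΦ, hs⟩ := (hp' φ hφ).exists_fin
  have hsum : ∀ x, ∑ i, Φ i x = φ x := fun x => by
    rw [← hs, _root_.sum_apply]
  have h1 := le_fblENorm f.toFun Φ fun x hx => by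
    calc ∑ i, |Φ i x| ≤ ∑ i, Φ i |x| := Finset.sum_le_sum fun i _ => (hΦ i).1.abs_le x
      _ = φ |x| := hsum _
      _ ≤ 1 := by
        refine (le_abs_self _).trans ((hb _).trans ?_)
        rwa [norm_abs_eq_norm]
  rw [← ENNReal.ofReal_sum_of_nonneg fun i _ => abs_nonneg _] at h1
  have h2 : ∑ i, |f.toFun (Φ i)| = ‖z‖ := by
    rw [← hn, ← hsum]
    exact Finset.sum_congr rfl fun i _ => (hΦ i).2 (Φ i) (hΦ i).1 fun x _ => by simp
  rw [h2] at h1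
  exact (ENNReal.ofReal_le_iff_le_toReal f.fblENorm_ne_top).1 h1

variable (X) in
/-- The closed vector sublattice of `H₀[X] × X` whose part over `FBL[X]` is the graph of the
canonical map. -/
def graph : Submodule ℝ (H0 X × X) := (preGraph X).topologicalClosure

theorem sup_mem_graph {p q : H0 X × X} (hp : p ∈ graph X) (hq : q ∈ graph X) :
    p ⊔ q ∈ graph X :=
  map_mem_closure₂ (f := fun a b : H0 X × X => a ⊔ b)
    (((continuous_fst.comp continuous_fst).sup (continuous_fst.comp continuous_snd)).prodMk
      ((continuous_snd.comp continuous_fst).sup (continuous_snd.comp continuous_snd))) hp hq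
    fun _ ha _ hb => sup_mem_preGraph ha hb

theorem norm_le_of_mem_graph {p : H0 X × X} (hp : p ∈ graph X) : ‖p.2‖ ≤ ‖p.1‖ :=
  closure_minimal (fun _ h => norm_le_of_mem_preGraph h)
    (isClosed_le (f := fun p : H0 X × X => ‖p.2‖) (g := fun p => ‖p.1‖)
      (by fun_prop) (by fun_prop)) hp

theorem graph_unique {f : H0 X} {z w : X} (hz : (f, z) ∈ graph X) (hw : (f, w) ∈ graph X) :
    z = w := by
  have := norm_le_of_mem_graph ((graph X).sub_mem hz hw)
  simp only [Prod.mk_sub_mk, sub_self, norm_zero] at this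
  exact sub_eq_zero.1 (norm_le_zero_iff.1 this)

theorem isClosed_graph_domain [CompleteSpace X] :
    IsClosed ((graph X).map (LinearMap.fst ℝ (H0 X) X) : Set (H0 X)) := by
  refine isClosed_of_closure_subset fun f hf => ?_
  obtain ⟨u, hu, hlim⟩ := mem_closure_iff_seq_limit.1 hf
  have hu' : ∀ n, ∃ z, (u n, z) ∈ graph X := fun n => by
    obtain ⟨⟨a, z⟩, h, e⟩ := hu n
    obtain rfl : a = u n := e
    exact ⟨z, h⟩
  choose z hz using hu'
  have hc : CauchySeq z := by
    refine Metric.cauchySeq_iff'.2 fun ε hε => ?_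
    obtain ⟨N, hN⟩ := Metric.cauchySeq_iff'.1 hlim.cauchySeq ε hε
    refine ⟨N, fun n hn => lt_of_le_of_lt ?_ (hN n hn)⟩
    rw [dist_eq_norm, dist_eq_norm]
    exact norm_le_of_mem_graph ((graph X).sub_mem (hz n) (hz N))
  obtain ⟨w, hw⟩ := cauchySeq_tendsto_of_complete hc
  exact ⟨(f, w), (preGraph X).isClosed_topologicalClosure.mem_of_tendsto
    (hlim.prodMk_nhds hw) (Filter.Eventually.of_forall hz), rfl⟩

theorem exists_mem_graph [CompleteSpace X] (f : FBL X) : ∃ z, ((f : H0 X), z) ∈ graph X := by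
  have hS := (Submodule.mem_sInf).1 f.2 ((graph X).map (LinearMap.fst ℝ (H0 X) X))
    ⟨isClosed_graph_domain, ?_, fun x =>
      ⟨(H0.delta x, x), subset_closure (delta_mem_preGraph x), rfl⟩⟩
  · obtain ⟨⟨a, z⟩, h, e⟩ := hS
    obtain rfl : a = f := e
    exact ⟨z, h⟩
  · rintro _ ⟨p, hp, rfl⟩ _ ⟨q, hq, rfl⟩
    exact ⟨⟨p ⊔ q, sup_mem_graph hp hq, rfl⟩,
      ⟨p ⊓ q, inf_mem_of_sup_mem _ (fun _ ha _ hb => sup_mem_graph ha hb) hp hq, rfl⟩⟩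

variable (X) in
/-- The canonical map `β_X : FBL[X] → X`. By `beta_isLatticeHom`, `beta_delta` and `beta_unique`
it is the unique lattice homomorphism such that `β_X ∘ δ_X = id_X`. -/
def beta [CompleteSpace X] : FBL X →L[ℝ] X :=
  LinearMap.mkContinuous
    { toFun := fun f => (exists_mem_graph f).choose
      map_add' := fun f g => graph_unique (exists_mem_graph (f + g)).choose_spec
        ((graph X).add_mem (exists_mem_graph f).choose_spec (exists_mem_graph g).choose_spec)
      map_smul' := fun c f => graph_unique (exists_mem_graph (c • f)).choose_spec
        ((graph X).smul_mem c (exists_mem_graph f).choose_spec) } 1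
    (fun f => by
      rw [one_mul]
      exact norm_le_of_mem_graph (exists_mem_graph f).choose_spec)

theorem beta_mem_graph [CompleteSpace X] (f : FBL X) : ((f : H0 X), beta X f) ∈ graph X :=
  (exists_mem_graph f).choose_spec

theorem beta_delta [CompleteSpace X] (x : X) : beta X (FBL.delta x) = x :=
  graph_unique (beta_mem_graph (FBL.delta x)) (subset_closure (delta_mem_preGraph x))

theorem beta_isLatticeHom [CompleteSpace X] : IsLatticeHom (beta X) := fun f g =>
  ⟨graph_unique (beta_mem_graph (f ⊔ g)) (sup_mem_graph (beta_mem_graph f) (beta_mem_graph g)),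
    graph_unique (beta_mem_graph (f ⊓ g)) (inf_mem_of_sup_mem _
      (fun _ ha _ hb => sup_mem_graph ha hb) (beta_mem_graph f) (beta_mem_graph g))⟩

theorem isClosed_FBL {E : Type*} [NormedAddCommGroup E] [NormedSpace ℝ E] :
    IsClosed (FBL E : Set (H0 E)) := by
  rw [FBL, Submodule.coe_sInf]
  exact isClosed_biInter fun S hS => hS.1

theorem beta_unique [CompleteSpace X] {γ : FBL X →L[ℝ] X} (h : IsLatticeHom γ)
    (hδ : ∀ x : X, γ (FBL.delta x) = x) : γ = beta X := by
  have key : FBL X ≤ (LinearMap.eqLocus γ.toLinearMap (beta X).toLinearMap).map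
      (FBL X).subtype := by
    refine sInf_le ⟨?_, ?_, fun x => ⟨FBL.delta x, ?_, rfl⟩⟩
    · have h1 : IsClosed {f : FBL X | γ f = beta X f} :=
        isClosed_eq γ.continuous (beta X).continuous
      exact (isClosed_FBL (E := X)).isClosedEmbedding_subtypeVal.isClosedMap _ h1
    · rintro _ ⟨f, hf, rfl⟩ _ ⟨g, hg, rfl⟩
      have hf' : γ f = beta X f := hf
      have hg' : γ g = beta X g := hg
      refine ⟨⟨f ⊔ g, ?_, rfl⟩, ⟨f ⊓ g, ?_, rfl⟩⟩
      · change γ (f ⊔ g) = beta X (f ⊔ g)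
        rw [(h f g).1, (beta_isLatticeHom f g).1, hf', hg']
      · change γ (f ⊓ g) = beta X (f ⊓ g)
        rw [(h f g).2, (beta_isLatticeHom f g).2, hf', hg']
    · change γ (FBL.delta x) = beta X (FBL.delta x)
      rw [hδ, beta_delta]
  ext f
  obtain ⟨g, hg, e⟩ := key f.2
  obtain rfl : g = f := Subtype.ext e
  exact hg

end CanonicalMap

section Lifting

variable (X : Type*) [NormedAddCommGroup X] [NormedSpace ℝ X] [Lattice X]

/-- The isometric lattice-lifting property: there is a lattice homomorphism `T : X → FBL[X]` with
`β_X ∘ T = id_X` and `‖T‖ = 1`. -/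
def IsometricLatticeLifting [CompleteSpace X] [HasSolidNorm X] [IsOrderedAddMonoid X]
    [IsOrderedModule ℝ X] : Prop :=
  ∃ T : X →L[ℝ] FBL X, IsLatticeHom T ∧ (∀ x : X, beta X (T x) = x) ∧ ‖T‖ = 1

/-- The set `Hom(X, ℝ) ∩ B_{X*}` of all real-valued lattice homomorphisms on `X` of norm at most
one, as a subset of the dual with the weak* topology. -/
def homBall : Set (WeakDual ℝ X) :=
  {φ | IsLatticeHom (WeakDual.toStrongDual φ) ∧ ‖WeakDual.toStrongDual φ‖ ≤ 1}

end Lifting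

/-- A compact Hausdorff space `K` is an absolute retract if it is a retract of any compact
Hausdorff space `L` containing it (as the image of a topological embedding `i`). -/
def IsAbsoluteRetract (K : Type u) [TopologicalSpace K] : Prop :=
  CompactSpace K ∧ T2Space K ∧
    ∀ (L : Type v) [TopologicalSpace L] [CompactSpace L] [T2Space L] (i : K → L),
      Topology.IsEmbedding i → ∃ r : L → K, Continuous r ∧ ∀ k : K, r (i k) = k

end BanachLattice

end

namespace BanachLattice

open Topology Metric

/-! ### Evaluation at functionals and weak* continuity on the dual ball -/

section Evaluation

variable {E : Type*} [NormedAddCommGroup E] [NormedSpace ℝ E]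

/-! A lifting `T` turns each functional `φ` in the dual ball into the lattice homomorphism `x ↦ (T
x)(φ)`. Its norm is at most one, because `|f(φ)| ≤ ‖f‖` for `‖φ‖ ≤ 1` and `‖T‖ = 1`. It depends
weak* continuously on `φ`, because elements of `FBL[X]` are weak* continuous on the dual ball
(`FBL.continuous_toFun`). If `φ` is already a lattice homomorphism, then evaluation at `φ` and `φ ∘
β_X` are lattice homomorphisms on `FBL[X]` that agree on generators, hence coincide (`FBL.hom_ext`),
and `β_X ∘ T = id` gives back `φ`. So `homBall X` is a retract of the dual ball
(`IsometricLatticeLifting.exists_retraction`).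

For separable `X` the dual ball is affinely homeomorphic to a compact convex subset of `ℓ²`. Tietze
extension in each coordinate, followed by the nearest-point projection, extends any continuous map
into it from a compact subspace of a compact Hausdorff space (`exists_extension_dualBall`). This
extension property passes to retracts; applied to the inclusion of `homBall X`, it gives the
theorem. -/

theorem H0.abs_toFun_le (f : H0 E) {φ : StrongDual ℝ E} (hφ : ‖φ‖ ≤ 1) : |f.toFun φ| ≤ ‖f‖ := by
  -- A single functional of norm at most one is an admissible family in the supremum.
  have h := le_fblENorm f.toFun (fun _ : Fin 1 => φ) fun x hx => by
    simpa using (φ.le_opNorm x).trans (mul_le_one₀ hφ (norm_nonneg x) hx)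
  simp only [Finset.univ_unique, Finset.sum_const, Finset.card_singleton, one_smul] at h
  exact (ENNReal.ofReal_le_iff_le_toReal f.fblENorm_ne_top).1 h

/-- Evaluation at a functional in the unit ball, as a bounded functional on `H₀[E]`. -/
noncomputable def H0.evalCLM (φ : StrongDual ℝ E) (hφ : ‖φ‖ ≤ 1) : H0 E →L[ℝ] ℝ :=
  LinearMap.mkContinuous
    { toFun := fun f => f.toFun φ
      map_add' := fun _ _ => rfl
      map_smul' := fun _ _ => rfl } 1
    fun f => by
      rw [one_mul]
      exact f.abs_toFun_le hφ

/-- Evaluation at a functional in the unit ball, as a bounded functional on `FBL[E]`. -/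
noncomputable def FBL.evalCLM (φ : StrongDual ℝ E) (hφ : ‖φ‖ ≤ 1) : FBL E →L[ℝ] ℝ :=
  (H0.evalCLM φ hφ).comp (FBL E).subtypeL

theorem FBL.evalCLM_isLatticeHom (φ : StrongDual ℝ E) (hφ : ‖φ‖ ≤ 1) :
    IsLatticeHom (FBL.evalCLM φ hφ) := fun _ _ => ⟨rfl, rfl⟩

theorem IsLatticeHom.comp {X Y Z : Type*} [NormedAddCommGroup X] [NormedSpace ℝ X] [Lattice X]
    [NormedAddCommGroup Y] [NormedSpace ℝ Y] [Lattice Y]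
    [NormedAddCommGroup Z] [NormedSpace ℝ Z] [Lattice Z] {S : Y →L[ℝ] Z} {T : X →L[ℝ] Y}
    (hS : IsLatticeHom S) (hT : IsLatticeHom T) : IsLatticeHom (S.comp T) := fun x y =>
  ⟨by simp [(hT x y).1, (hS _ _).1], by simp [(hT x y).2, (hS _ _).2]⟩

/-- Lattice homomorphisms on `FBL[E]` are determined by their values at the generators. -/
theorem FBL.hom_ext {Y : Type*} [NormedAddCommGroup Y] [NormedSpace ℝ Y] [Lattice Y]
    {γ γ' : FBL E →L[ℝ] Y} (h : IsLatticeHom γ) (h' : IsLatticeHom γ')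
    (hδ : ∀ x : E, γ (FBL.delta x) = γ' (FBL.delta x)) : γ = γ' := by
  -- `FBL E` is the least closed sublattice of `H0 E` containing the evaluations, so it suffices
  -- that the equalizer, viewed in `H0 E`, is another one. It is closed there because `FBL E` itself
  -- is closed.
  have key : FBL E ≤ (LinearMap.eqLocus γ.toLinearMap γ'.toLinearMap).map (FBL E).subtype := by
    refine sInf_le ⟨?_, ?_, fun x => ⟨FBL.delta x, hδ x, rfl⟩⟩
    · have h1 : IsClosed {f : FBL E | γ f = γ' f} := isClosed_eq γ.continuous γ'.continuous
      exact isClosed_FBL.isClosedEmbedding_subtypeVal.isClosedMap _ h1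
    · rintro _ ⟨f, hf, rfl⟩ _ ⟨g, hg, rfl⟩
      have hf' : γ f = γ' f := hf
      have hg' : γ g = γ' g := hg
      refine ⟨⟨f ⊔ g, ?_, rfl⟩, ⟨f ⊓ g, ?_, rfl⟩⟩
      · change γ (f ⊔ g) = γ' (f ⊔ g)
        rw [(h f g).1, (h' f g).1, hf', hg']
      · change γ (f ⊓ g) = γ' (f ⊓ g)
        rw [(h f g).2, (h' f g).2, hf', hg']
  ext f
  obtain ⟨g, hg, e⟩ := key f.2
  obtain rfl : g = f := Subtype.ext e
  exact hg

variable (E) in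
/-- The closed unit ball of the dual, with the weak* topology. -/
abbrev dualBall : Set (WeakDual ℝ E) := WeakDual.toStrongDual ⁻¹' closedBall 0 1

theorem norm_le_of_mem_dualBall (φ : dualBall E) : ‖WeakDual.toStrongDual φ.1‖ ≤ 1 :=
  mem_closedBall_zero_iff.1 φ.2

variable (E) in
/-- The elements of `H₀[E]` that are weak* continuous on the unit ball of the dual. -/
def weakStarContinuous : Submodule ℝ (H0 E) where
  carrier := {f | Continuous fun φ : dualBall E => f.toFun (WeakDual.toStrongDual φ.1)}
  zero_mem' := (continuous_const : Continuous fun _ : dualBall E => (0 : ℝ))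
  add_mem' hf hg := hf.add hg
  smul_mem' c _ hf := hf.const_mul c

/-- The norm dominates the supremum over the dual ball, so norm limits are uniform limits there and
preserve continuity. -/
theorem isClosed_weakStarContinuous : IsClosed (weakStarContinuous E : Set (H0 E)) := by
  refine isClosed_of_closure_subset fun f hf => ?_
  change Continuous fun φ : dualBall E => f.toFun (WeakDual.toStrongDual φ.1)
  refine continuous_of_uniform_approx_of_continuous fun u hu => ?_
  obtain ⟨ε, hε, hεu⟩ := Metric.mem_uniformity_dist.1 hu
  obtain ⟨g, hg, hfg⟩ := Metric.mem_closure_iff.1 hf ε hε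
  refine ⟨_, hg, fun φ => hεu ?_⟩
  rw [dist_eq_norm] at hfg
  exact ((f - g).abs_toFun_le (norm_le_of_mem_dualBall φ)).trans_lt hfg

/-- Evaluations are weak* continuous, and continuity survives lattice operations and norm limits;
minimality of `FBL E` does the rest. -/
theorem FBL.continuous_toFun (f : FBL E) :
    Continuous fun φ : dualBall E => (f : H0 E).toFun (WeakDual.toStrongDual φ.1) := by
  have h : FBL E ≤ weakStarContinuous E := sInf_le ⟨isClosed_weakStarContinuous,
    fun f hf g hg => ⟨Continuous.sup hf hg, Continuous.inf hf hg⟩,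
    fun x => (WeakDual.eval_continuous x).comp continuous_subtype_val⟩
  exact h f.2

end Evaluation

/-! ### Retraction of the dual ball onto the lattice homomorphisms -/

section Retraction

variable {X : Type*} [NormedAddCommGroup X] [NormedSpace ℝ X] [CompleteSpace X] [Lattice X]
  [HasSolidNorm X] [IsOrderedAddMonoid X] [IsOrderedModule ℝ X]

/-- A lattice-lifting yields a weak* continuous retraction of the unit ball of the dual onto its
lattice homomorphisms. -/
theorem IsometricLatticeLifting.exists_retraction (hX : IsometricLatticeLifting X) :
    ∃ r : dualBall X → homBall X, Continuous r ∧
      ∀ (φ : homBall X) (h : φ.1 ∈ dualBall X), r ⟨φ.1, h⟩ = φ := by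
  obtain ⟨T, hT, hβ, hn⟩ := hX
  let S : dualBall X → StrongDual ℝ X := fun φ =>
    (FBL.evalCLM _ (norm_le_of_mem_dualBall φ)).comp T
  have hS : ∀ φ, ‖S φ‖ ≤ 1 := fun φ => by
    refine ContinuousLinearMap.opNorm_le_bound _ zero_le_one fun x => ?_
    refine ((T x : H0 X).abs_toFun_le (norm_le_of_mem_dualBall φ)).trans ?_
    have := T.le_opNorm x
    -- The isometric condition keeps the image inside the unit ball.
    rwa [hn] at this
  refine ⟨fun φ => ⟨StrongDual.toWeakDual (S φ),
    (FBL.evalCLM_isLatticeHom _ (norm_le_of_mem_dualBall φ)).comp hT, hS φ⟩, ?_, ?_⟩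
  · exact (WeakDual.continuous_of_continuous_eval fun x =>
      FBL.continuous_toFun (T x)).subtype_mk _
  · intro φ h
    -- Both sides send `δ(x)` to `φ x`. The right side is a lattice homomorphism because `φ` is one.
    have e : FBL.evalCLM _ (norm_le_of_mem_dualBall ⟨φ.1, h⟩) =
        (WeakDual.toStrongDual φ.1).comp (beta X) := by
      refine FBL.hom_ext (FBL.evalCLM_isLatticeHom _ _) (φ.2.1.comp beta_isLatticeHom) fun x => ?_
      rw [ContinuousLinearMap.comp_apply, beta_delta]
      rfl
    refine Subtype.ext (DFunLike.ext _ _ fun x => ?_)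
    change FBL.evalCLM _ (norm_le_of_mem_dualBall ⟨φ.1, h⟩) (T x) = φ.1 x
    rw [e, ContinuousLinearMap.comp_apply, hβ]
    rfl

end Retraction

/-! ### Extension of maps into the dual ball of a separable space -/

section Extension

/-- The nearest-point map onto a complete convex set in a Hilbert space is continuous. -/
theorem exists_retraction_of_convex {H : Type*} [NormedAddCommGroup H] [InnerProductSpace ℝ H]
    {C : Set H} (hne : C.Nonempty) (hC : IsComplete C) (hconv : Convex ℝ C) :
    ∃ p : H → C, Continuous p ∧ ∀ c : C, p c = c := by
  have hp : ∀ u : H, ∃ v : C, ∀ w ∈ C, inner ℝ (u - v) (w - v) ≤ 0 := fun u => by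
    obtain ⟨v, hv, h⟩ := exists_norm_eq_iInf_of_complete_convex hne hC hconv u
    exact ⟨⟨v, hv⟩, (norm_eq_iInf_iff_real_inner_le_zero hconv hv).1 h⟩
  choose p hp using hp
  -- Add the variational inequalities at `a` and `b`, each tested against the other's projection,
  -- then apply Cauchy–Schwarz and cancel one factor.
  have hlip : ∀ a b, ‖(p a : H) - p b‖ ≤ ‖a - b‖ := fun a b => by
    have h1 := hp a (p b) (p b).2
    have h2 := hp b (p a) (p a).2
    have h3 : ‖(p a : H) - p b‖ * ‖(p a : H) - p b‖ ≤ ‖a - b‖ * ‖(p a : H) - p b‖ := by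
      refine le_trans ?_ (real_inner_le_norm (a - b) ((p a : H) - p b))
      rw [← real_inner_self_eq_norm_mul_norm]
      have e : inner ℝ ((p a : H) - p b) ((p a : H) - p b) = inner ℝ (a - b) ((p a : H) - p b)
          + inner ℝ (a - p a) ((p b : H) - p a) + inner ℝ (b - p b) ((p a : H) - p b) := by
        simp only [inner_sub_left, inner_sub_right]
        ring
      linarith
    rcases (norm_nonneg ((p a : H) - p b)).eq_or_lt with h | h
    · rw [← h]
      exact norm_nonneg _
    · exact le_of_mul_le_mul_right h3 h
  refine ⟨p, ?_, fun c => Subtype.ext ?_⟩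
  · have : LipschitzWith 1 p := LipschitzWith.of_dist_le_mul fun a b => by
      rw [NNReal.coe_one, one_mul, Subtype.dist_eq, dist_eq_norm, dist_eq_norm]
      exact hlip a b
    exact this.continuous
  -- Testing the variational inequality at `c` itself gives `‖c - p c‖² ≤ 0`.
  · have h := hp c c c.2
    rw [real_inner_self_nonpos, sub_eq_zero] at h
    exact h.symm

/-- The space `ℓ²` of square-summable real sequences. -/
abbrev EllTwo : Type := lp (fun _ : ℕ => ℝ) 2

/-- The standard map from the cube of sequences in `[-1, 1]` to `ℓ²`, with weights `2⁻ⁿ`. -/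
noncomputable def cubeMap (a : ℕ → ℝ) : EllTwo := ∑' n, lp.single 2 n ((1 / 2 : ℝ) ^ n * a n)

theorem norm_single_weight_le {a : ℕ → ℝ} (ha : ∀ n, |a n| ≤ 1) (n : ℕ) :
    ‖(lp.single 2 n ((1 / 2 : ℝ) ^ n * a n) : EllTwo)‖ ≤ (1 / 2 : ℝ) ^ n := by
  rw [lp.norm_single (by norm_num), norm_mul, Real.norm_eq_abs (a n), norm_pow]
  norm_num
  exact ha n

theorem summable_single_weight {a : ℕ → ℝ} (ha : ∀ n, |a n| ≤ 1) :
    Summable fun n => (lp.single 2 n ((1 / 2 : ℝ) ^ n * a n) : EllTwo) :=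
  Summable.of_norm_bounded summable_geometric_two (norm_single_weight_le ha)

/-- Coordinate functionals are continuous, so they commute with the sum. The bound on `a` ensures
summability; otherwise `tsum` could take its default value zero. -/
theorem cubeMap_apply {a : ℕ → ℝ} (ha : ∀ n, |a n| ≤ 1) (n : ℕ) :
    cubeMap a n = (1 / 2 : ℝ) ^ n * a n := by
  have h := (summable_single_weight ha).hasSum.mapL (lp.evalCLM ℝ (fun _ : ℕ => ℝ) 2 n)
  refine h.unique ?_
  convert hasSum_single n ?_ using 1
  · simp [lp.evalCLM]
  · intro m hm
    simp [lp.evalCLM, hm.symm]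

/-- Weierstrass M-test: the summands are continuous and bounded by `2⁻ⁿ` uniformly in `z`. -/
theorem continuous_cubeMap {Z : Type*} [TopologicalSpace Z] {a : Z → ℕ → ℝ} (hc : Continuous a)
    (ha : ∀ z n, |a z n| ≤ 1) : Continuous fun z => cubeMap (a z) := by
  refine continuous_tsum (fun n => ?_) summable_geometric_two
    fun n z => norm_single_weight_le (ha z) n
  exact (lp.singleContinuousLinearMap ℝ (fun _ : ℕ => ℝ) 2 n).continuous.comp
    (((continuous_apply n).comp hc).const_mul _)

/-- The unit ball of the dual of a separable space, with the weak* topology, has the extension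
property for maps on compact subspaces of compact Hausdorff spaces. -/
theorem exists_extension_dualBall {E : Type*} [NormedAddCommGroup E] [NormedSpace ℝ E]
    [TopologicalSpace.SeparableSpace E] {K L : Type*} [TopologicalSpace K] [CompactSpace K]
    [TopologicalSpace L] [CompactSpace L] [T2Space L] {i : K → L} (hi : IsEmbedding i)
    {f : K → dualBall E} (hf : Continuous f) :
    ∃ g : L → dualBall E, Continuous g ∧ ∀ k, g (i k) = f k := by
  -- A dense sequence rescaled into the unit ball, so that functionals in the dual ball take values
  -- in `[-1, 1]` on it. Adding `1` avoids division by zero.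
  let u : ℕ → E := fun n =>
    (1 + ‖TopologicalSpace.denseSeq E n‖)⁻¹ • TopologicalSpace.denseSeq E n
  have hu : ∀ n, ‖u n‖ ≤ 1 := fun n => by
    have h : 0 < 1 + ‖TopologicalSpace.denseSeq E n‖ := by positivity
    rw [norm_smul, norm_inv, Real.norm_of_nonneg h.le, inv_mul_le_one₀ h]
    linarith
  let a : dualBall E → ℕ → ℝ := fun φ n => φ.1 (u n)
  have ha : ∀ φ n, |a φ n| ≤ 1 := fun φ n =>
    ((WeakDual.toStrongDual φ.1).le_opNorm (u n)).trans
      (mul_le_one₀ (norm_le_of_mem_dualBall φ) (norm_nonneg _) (hu n))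
  have hac : Continuous a := continuous_pi fun n =>
    (WeakDual.eval_continuous (u n)).comp continuous_subtype_val
  -- The weights and scalings are nonzero, so the image determines `φ` on a dense sequence, hence
  -- everywhere.
  have hinj : Function.Injective fun φ => cubeMap (a φ) := fun φ ψ h => by
    refine Subtype.ext (DFunLike.coe_injective ?_)
    refine (TopologicalSpace.denseRange_denseSeq E).equalizer φ.1.continuous ψ.1.continuous
      (funext fun n => ?_)
    have h1 := cubeMap_apply (ha φ) n
    rw [show cubeMap (a φ) = cubeMap (a ψ) from h, cubeMap_apply (ha ψ) n] at h1
    have h2 : ψ.1 (u n) = φ.1 (u n) := mul_left_cancel₀ (by positivity) h1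
    have h3 : (1 + ‖TopologicalSpace.denseSeq E n‖)⁻¹ ≠ 0 := by positivity
    simp only [u, map_smul, smul_eq_mul] at h2
    exact (mul_left_cancel₀ h3 h2).symm
  have : CompactSpace (dualBall E) :=
    isCompact_iff_compactSpace.1 (WeakDual.isCompact_closedBall 0 1)
  -- A continuous injection from a compact space into a Hausdorff space is a closed embedding.
  have hemb := (continuous_cubeMap hac ha).isClosedEmbedding hinj
  have hconv : Convex ℝ (Set.range fun φ => cubeMap (a φ)) := by
    rintro _ ⟨φ, rfl⟩ _ ⟨ψ, rfl⟩ s t hs ht hst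
    have hmem : s • φ.1 + t • ψ.1 ∈ dualBall E :=
      (convex_closedBall (0 : StrongDual ℝ E) 1) φ.2 ψ.2 hs ht hst
    refine ⟨⟨_, hmem⟩, lp.ext (funext fun n => ?_)⟩
    simp only [lp.coeFn_add, lp.coeFn_smul, Pi.add_apply, Pi.smul_apply, smul_eq_mul]
    rw [cubeMap_apply (ha _), cubeMap_apply (ha _), cubeMap_apply (ha _)]
    change _ * (s * φ.1 (u n) + t * ψ.1 (u n)) = s * (_ * φ.1 (u n)) + t * (_ * ψ.1 (u n))
    ring
  have hne : (Set.range fun φ => cubeMap (a φ)).Nonempty :=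
    ⟨_, ⟨0, by simp⟩, rfl⟩
  obtain ⟨p, hp, hpC⟩ :=
    exists_retraction_of_convex hne hemb.isClosed_range.isComplete hconv
  -- Tietze in each coordinate. Values stay in `[-1, 1]`, so `cubeMap` is continuous along the
  -- extended sequence.
  have hext : ∀ n, ∃ b : C(L, ℝ), (∀ l, b l ∈ Set.Icc (-1 : ℝ) 1) ∧
      ∀ k, b (i k) = a (f k) n := fun n => by
    obtain ⟨b, hb, he⟩ := ContinuousMap.exists_extension_forall_mem_of_isClosedEmbedding
      (⟨fun k => a (f k) n, (continuous_apply n).comp (hac.comp hf)⟩ : C(K, ℝ))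
      (t := Set.Icc (-1) 1) (fun k => abs_le.1 (ha (f k) n)) ⟨0, by norm_num⟩
      (hi.continuous.isClosedEmbedding hi.injective)
    exact ⟨b, hb, fun k => congrFun he k⟩
  choose b hb he using hext
  have hbc : Continuous fun l => cubeMap fun n => b n l :=
    continuous_cubeMap (continuous_pi fun n => (b n).continuous) fun l n => abs_le.2 (hb n l)
  -- Off `K` the extended point may leave the image of the dual ball; `p` brings it back while
  -- fixing the points coming from `K`.
  refine ⟨fun l => hemb.isEmbedding.toHomeomorph.symm (p (cubeMap fun n => b n l)),
    hemb.isEmbedding.toHomeomorph.symm.continuous.comp (hp.comp hbc), fun k => ?_⟩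
  simp only [he]
  rw [Homeomorph.symm_apply_eq]
  exact hpC ⟨_, f k, rfl⟩

end Extension

end BanachLattice

theorem corollary3p10 (X : Type u) [NormedAddCommGroup X] [NormedSpace ℝ X]
    [CompleteSpace X] [Lattice X] [HasSolidNorm X] [IsOrderedAddMonoid X] [IsOrderedModule ℝ X]
    [TopologicalSpace.SeparableSpace X] (hX : BanachLattice.IsometricLatticeLifting X) :
    BanachLattice.IsAbsoluteRetract.{u, v} (BanachLattice.homBall X) := by
  obtain ⟨r, hr, hrK⟩ := hX.exists_retraction
  have hmem : ∀ φ : BanachLattice.homBall X, φ.1 ∈ BanachLattice.dualBall X :=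
    fun φ => mem_closedBall_zero_iff.2 φ.2.2
  have : CompactSpace (BanachLattice.dualBall X) :=
    isCompact_iff_compactSpace.1 (WeakDual.isCompact_closedBall 0 1)
  have hsurj : Function.Surjective r := fun φ => ⟨⟨φ.1, hmem φ⟩, hrK φ _⟩
  have hK : CompactSpace (BanachLattice.homBall X) := hsurj.compactSpace hr
  refine ⟨hK, inferInstance, fun L _ _ _ i hi => ?_⟩
  -- Extend the inclusion of `homBall X` into the dual ball over `L`, then retract by `r`.
  obtain ⟨g, hg, hgi⟩ := BanachLattice.exists_extension_dualBall hi
    (f := fun φ : BanachLattice.homBall X => (⟨φ.1, hmem φ⟩ : BanachLattice.dualBall X))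
    (continuous_subtype_val.subtype_mk _)
  exact ⟨r ∘ g, hr.comp hg, fun φ => by rw [Function.comp_apply, hgi, hrK]⟩
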